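/- **Setting.** Let $r>0$, let $L$ be a number of layers and $p_0,p_1,\dots$ be dimensions; let $B_{r}=\{x\in\mathbb R^{p_0}:\|x\|_2\le r\}$. For a set $E$ of edge features let $V_1(\mathcal G_E)$ be the class of pairs $(G,u)$, where $G$ is a finite undirected graph of any size without isolated vertices, with vertex attributes $a_G(v)\in B_r$ and edge features $w_{uv}=w_{vu}\in E$, and $u\in V(G)$. Let $\Theta$ be any parameter set. For each $\theta\in\Theta$ and $1\le t\le L$ let $\phi_t^\theta:\mathbb R^{p_{t-1}}\times\mathbb R^{p_{t-1}}\to\mathbb R^{p_t}$ satisfy $\|\phi_t^\theta(x,y)-\phi_t^\theta(x',y')\|_2\le C_1\|x-x'\|_2+C_2\|y-y'\|_2$ for some $C_1,C_2>0$ (which may depend on $\theta,t$). A family $f_\theta:\mathcal X\to\mathbb R^{d}$ ($\theta\in\Theta$) on a non-empty set is a *finite Lipschitz class* with respect to a pseudo-metric $d_{\mathcal X}$ if every $f_\theta$ is Lipschitz for $d_{\mathcal X}$ and, for every $\varepsilon>0$, $\mathcal X$ is covered by finitely many closed $d_{\mathcal X}$-balls of radius $\varepsilon$ centred in $\mathcal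 X$. **Architectures.** All start from $h^{(0)}_u=a_G(u)$, and $f_\theta(G,u)=h_u^{(L)}$, where, for $1\le t\le L$, - (sum) $h_u^{(t)}=\phi_t^\theta\big(h_u^{(t-1)},\tfrac1{|V(G)|}\sum_{v\in N(u)}w_{uv}h_v^{(t-1)}\big)$; - (mean) $h_u^{(t)}=\phi_t^\theta\big(h_u^{(t-1)},\tfrac1{\deg(u)}\sum_{v\in N(u)}w_{uv}h_v^{(t-1)}\big)$, $\deg(u)=\sum_{v\in N(u)}w_{uv}$; - (max / min) $h_u^{(t)}=\phi_t^\theta\big(h_u^{(t-1)},\max_{v\in N(u)}M_t^\theta(h_v^{(t-1)},w_{uv})\big)$ with coordinatewise maximum, respectively minimum. **Representation spaces.** *Iterated degree measures*: $H_0=B_r$ with $d_0(x,y)=\|x-y\|_2$, and $H_{t+1}=H_t\times\mathcal M_{\le1}(H_t)$ with $d_{t+1}\big((\eta,\mu),(\eta',\mu')\big)=d_t(\eta,\eta')+\mathbf K(\mu,\mu')$, where $\mathcal M_{\le 1}$ denotes Borel measures of mass at most $1$ and $\mathbf K(\mu,\nu)=\sup\{|\int f\,d\mu-\int f\,d\nu|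 : f\ 1\text{-Lipschitz},\ \|f\|_\infty\le1\}$. *Iterated neighborhood sets*: $H^{\max}_0=B_r$ with the Euclidean distance, and $H^{\max}_{t+1}=H^{\max}_t\times\mathrm{Haus}(H^{\max}_t\times E)$, where $\mathrm{Haus}$ is the set of non-empty compact subsets with the Hausdorff metric, $E$ carries the distance of the norm, and products carry the sum of the two distances. **Theorem.** 1. The metric space $H_L$ is compact. Let $E\subset\mathbb R_{>0}$ be compact and non-empty. (a) Let $W$ be any number with $E\subseteq(0,W]$ ($W=1$ if $E\subseteq(0,1]$). Put $\eta_u^{(0)}=a_G(u)$, $\eta_u^{(t+1)}=\big(\eta_u^{(t)},\tfrac1{|V(G)|}\sum_{v\in N(u)}\tfrac{w_{uv}}{W}\delta_{\eta_v^{(t)}}\big)\in H_{t+1}$. The class of normalized-sum MPNNs is a finite Lipschitz class on $V_1(\mathcal G_E)$ with respect to $d_{\mathrm{sum},L}((G,u),(G',u'))=d_L(\eta_u^{(L)},\eta_{u'}^{(L)})$. (b) Put $\overline\eta_u^{(0)}=a_G(u)$, $\overline\eta_u^{(t+1)}=\big(\overline\eta_u^{(t)},\tfrac1{\deg(u)}\sum_{v\in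 N(u)}w_{uv}\delta_{\overline\eta_v^{(t)}}\big)\in H_{t+1}$. The class of mean-aggregation MPNNs is a finite Lipschitz class on $V_1(\mathcal G_E)$ with respect to $d_{\mathrm{mean},L}((G,u),(G',u'))=d_L(\overline\eta_u^{(L)},\overline\eta_{u'}^{(L)})$. 2. Let $E$ be a non-empty compact subset of a real normed space $F$ (for instance $\mathbb R$ or $\mathbb R^{d_e}$), and for $\theta\in\Theta$, $1\le t\le L$ let $M_t^\theta:\mathbb R^{p_{t-1}}\times F\to\mathbb R^{p_{t-1}}$ satisfy $\|M_t^\theta(x,y)-M_t^\theta(x',y')\|_2\le C_1\|x-x'\|_2+C_2\|y-y'\|$ for some $C_1,C_2>0$ (which may depend on $\theta,t$). Then $H_L^{\max}$ is compact. Put $\hat\eta_u^{(0)}=a_G(u)$, $\hat\eta_u^{(t+1)}=\big(\hat\eta_u^{(t)},\{(\hat\eta_v^{(t)},w_{uv}):v\in N(u)\}\big)\in H^{\max}_{t+1}$, and let $d_{\max,L}((G,u),(G',u'))$ be the distance of $\hat\eta_u^{(L)}$ and $\hat\eta_{u'}^{(L)}$ in $H_L^{\max}$. The class of max-aggregation MPNNs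 and the class of min-aggregation MPNNs are finite Lipschitz classes on $V_1(\mathcal G_E)$ with respect to $d_{\max,L}$. -/

import Mathlib

open MeasureTheory
open scoped NNReal ENNReal

noncomputable section

/-! ### Attributed, edge-featured graphs -/

/-- A finite undirected graph without isolated vertices whose vertices carry attributes in the
closed Euclidean ball of radius `r` in `ℝ^{p₀}` and whose edges carry features in `E`. -/
structure AttributedGraph (p₀ : ℕ) (r : ℝ) {F : Type} (E : Set F) where
  V : Type
  [fintypeV : Fintype V]
  graph : SimpleGraph V
  attr : V → Metric.closedBall (0 : EuclideanSpace ℝ (Fin p₀)) r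
  edgeFeature : graph.edgeSet → E
  exists_adj : ∀ u, ∃ v, graph.Adj u v

namespace AttributedGraph

variable {p₀ : ℕ} {r : ℝ} {F : Type} {E : Set F}

attribute [instance] AttributedGraph.fintypeV

/-- The neighborhood `N(u)`, as a type. -/
abbrev Nbr (G : AttributedGraph p₀ r E) (u : G.V) : Type := G.graph.neighborSet u

instance (G : AttributedGraph p₀ r E) (u : G.V) : Fintype (G.Nbr u) := Fintype.ofFinite _

instance (G : AttributedGraph p₀ r E) (u : G.V) : Nonempty (G.Nbr u) :=
  let ⟨v, hv⟩ := G.exists_adj u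
  ⟨⟨v, hv⟩⟩

/-- The feature `w_{uv}` of the edge between `u` and its neighbor `v`. -/
def w (G : AttributedGraph p₀ r E) (u : G.V) (v : G.Nbr u) : E :=
  G.edgeFeature ⟨s(u, v.1), v.2⟩

/-- The weighted degree `∑_{v ∈ N(u)} w_{uv}`. -/
def deg {E : Set ℝ} (G : AttributedGraph p₀ r E) (u : G.V) : ℝ :=
  ∑ v : G.Nbr u, (G.w u v : ℝ)

end AttributedGraph

/-- Pairs `(G, u)` of a graph and one of its vertices. -/
def RootedGraph (p₀ : ℕ) (r : ℝ) {F : Type} (E : Set F) : Type 1 :=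
  Σ G : AttributedGraph p₀ r E, G.V

/-! ### Finite Lipschitz classes -/

/-- The family `f_θ : X → Y` is a finite Lipschitz class with respect to the pseudo-metric `d`:
every `f_θ` has a finite Lipschitz constant, and all covering numbers of `(X, d)` are finite. -/
structure IsFiniteLipschitzClass {X Θ Y : Type*} [PseudoMetricSpace Y]
    (d : PseudoMetricSpace X) (f : Θ → X → Y) : Prop where
  nonempty : Nonempty X
  lipschitz : ∀ θ, ∃ K : ℝ≥0, LipschitzWith K (f θ)
  covering : ∀ ε : ℝ≥0, 0 < ε → Metric.coveringNumber ε (Set.univ : Set X) < ⊤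

/-- `‖f(x,y) - f(x',y')‖ ≤ C₁ ‖x-x'‖ + C₂ ‖y-y'‖` for some constants `C₁, C₂ > 0`. -/
def IsLipschitzInPair {X Y Z : Type*} [NormedAddCommGroup X] [NormedAddCommGroup Y]
    [NormedAddCommGroup Z] (f : X → Y → Z) : Prop :=
  ∃ C₁ C₂ : ℝ, 0 < C₁ ∧ 0 < C₂ ∧ ∀ x x' y y',
    ‖f x y - f x' y'‖ ≤ C₁ * ‖x - x'‖ + C₂ * ‖y - y'‖

/-! ### Message passing neural networks

The index `t` is shifted by one: `φ t` and `M t` are the update and message maps of layer `t + 1`,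
from `ℝ^{p t}` to `ℝ^{p (t + 1)}`. -/

/-- Update maps `ℝ^{p t} × ℝ^{p t} → ℝ^{p (t+1)}`. -/
abbrev UpdateMaps (p : ℕ → ℕ) : Type :=
  ∀ t, EuclideanSpace ℝ (Fin (p t)) → EuclideanSpace ℝ (Fin (p t)) →
    EuclideanSpace ℝ (Fin (p (t + 1)))

/-- Message maps `ℝ^{p t} × F → ℝ^{p t}`. -/
abbrev MessageMaps (p : ℕ → ℕ) (F : Type) : Type :=
  ∀ t, EuclideanSpace ℝ (Fin (p t)) → F → EuclideanSpace ℝ (Fin (p t))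

section MPNN

variable {p : ℕ → ℕ} {r : ℝ}

/-- Normalized-sum aggregation. -/
def sumFeature {E : Set ℝ} (φ : UpdateMaps p) (G : AttributedGraph (p 0) r E) :
    ∀ t, G.V → EuclideanSpace ℝ (Fin (p t))
  | 0, u => (G.attr u : EuclideanSpace ℝ (Fin (p 0)))
  | t + 1, u => φ t (sumFeature φ G t u)
      ((Fintype.card G.V : ℝ)⁻¹ • ∑ v : G.Nbr u, (G.w u v : ℝ) • sumFeature φ G t v)

/-- Mean aggregation. -/
def meanFeature {E : Set ℝ} (φ : UpdateMaps p) (G : AttributedGraph (p 0) r E) :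
    ∀ t, G.V → EuclideanSpace ℝ (Fin (p t))
  | 0, u => (G.attr u : EuclideanSpace ℝ (Fin (p 0)))
  | t + 1, u => φ t (meanFeature φ G t u)
      ((G.deg u)⁻¹ • ∑ v : G.Nbr u, (G.w u v : ℝ) • meanFeature φ G t v)

/-- Coordinatewise maximum of finitely many vectors. -/
def coordMax {ι : Type} [Fintype ι] [Nonempty ι] {n : ℕ} (x : ι → EuclideanSpace ℝ (Fin n)) :
    EuclideanSpace ℝ (Fin n) :=
  WithLp.toLp 2 fun i => Finset.univ.sup' Finset.univ_nonempty fun j => x j i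

/-- Coordinatewise minimum of finitely many vectors. -/
def coordMin {ι : Type} [Fintype ι] [Nonempty ι] {n : ℕ} (x : ι → EuclideanSpace ℝ (Fin n)) :
    EuclideanSpace ℝ (Fin n) :=
  WithLp.toLp 2 fun i => Finset.univ.inf' Finset.univ_nonempty fun j => x j i

/-- Max aggregation. -/
def maxFeature {F : Type} {E : Set F} (φ : UpdateMaps p) (M : MessageMaps p F)
    (G : AttributedGraph (p 0) r E) : ∀ t, G.V → EuclideanSpace ℝ (Fin (p t))
  | 0, u => (G.attr u : EuclideanSpace ℝ (Fin (p 0)))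
  | t + 1, u => φ t (maxFeature φ M G t u)
      (coordMax fun v : G.Nbr u => M t (maxFeature φ M G t v) (G.w u v))

/-- Min aggregation. -/
def minFeature {F : Type} {E : Set F} (φ : UpdateMaps p) (M : MessageMaps p F)
    (G : AttributedGraph (p 0) r E) : ∀ t, G.V → EuclideanSpace ℝ (Fin (p t))
  | 0, u => (G.attr u : EuclideanSpace ℝ (Fin (p 0)))
  | t + 1, u => φ t (minFeature φ M G t u)
      (coordMin fun v : G.Nbr u => M t (minFeature φ M G t v) (G.w u v))

end MPNN

/-! ### Sub-probability measures with the Kantorovich–Rubinshtein distance -/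

/-- `M_{≤ 1}(X)`: measures of total mass at most one. -/
def SubProb (X : Type) [MeasurableSpace X] : Type := {μ : Measure X // μ Set.univ ≤ 1}

/-- Test functions of the Kantorovich–Rubinshtein distance: `1`-Lipschitz and bounded by `1`. -/
def KRTest (X : Type) [MetricSpace X] : Type :=
  {f : X → ℝ // (∀ x x', |f x - f x'| ≤ dist x x') ∧ ∀ x, |f x| ≤ 1}

namespace SubProb

variable {X : Type} [MetricSpace X] [MeasurableSpace X]

instance (μ : SubProb X) : IsFiniteMeasure μ.1 := ⟨μ.2.trans_lt ENNReal.one_lt_top⟩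

/-- The Kantorovich–Rubinshtein distance. -/
def krDist (μ ν : SubProb X) : ℝ := ⨆ f : KRTest X, |∫ x, f.1 x ∂μ.1 - ∫ x, f.1 x ∂ν.1|

lemma abs_integral_le_one (μ : SubProb X) (f : KRTest X) : |∫ x, f.1 x ∂μ.1| ≤ 1 := by
  have h := norm_integral_le_of_norm_le_const (μ := μ.1) (f := f.1) (C := 1)
    (Filter.Eventually.of_forall fun x => by simpa using f.2.2 x)
  have h1 : μ.1.real Set.univ ≤ 1 := by
    simpa [Measure.real] using ENNReal.toReal_mono ENNReal.one_ne_top μ.2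
  rw [Real.norm_eq_abs] at h
  linarith

lemma bddAbove_kr (μ ν : SubProb X) :
    BddAbove (Set.range fun f : KRTest X => |∫ x, f.1 x ∂μ.1 - ∫ x, f.1 x ∂ν.1|) := by
  refine ⟨2, ?_⟩
  rintro _ ⟨f, rfl⟩
  have h1 := abs_le.1 (abs_integral_le_one μ f)
  have h2 := abs_le.1 (abs_integral_le_one ν f)
  exact abs_le.2 ⟨by linarith, by linarith⟩

lemma le_krDist (μ ν : SubProb X) (f : KRTest X) :
    |∫ x, f.1 x ∂μ.1 - ∫ x, f.1 x ∂ν.1| ≤ krDist μ ν :=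
  le_ciSup (bddAbove_kr μ ν) f

instance : Nonempty (KRTest X) := ⟨⟨fun _ => 0, by simp, by simp⟩⟩

lemma krDist_triangle (μ ν ρ : SubProb X) : krDist μ ρ ≤ krDist μ ν + krDist ν ρ :=
  ciSup_le fun f => (abs_sub_le _ (∫ x, f.1 x ∂ν.1) _).trans
    (add_le_add (le_krDist μ ν f) (le_krDist ν ρ f))

lemma eq_of_krDist_eq_zero [BorelSpace X] (μ ν : SubProb X) (h : krDist μ ν = 0) : μ = ν := by
  have key : ∀ f : KRTest X, ∫ x, f.1 x ∂μ.1 = ∫ x, f.1 x ∂ν.1 := fun f =>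
    sub_eq_zero.1 (abs_nonpos_iff.1 ((le_krDist μ ν f).trans h.le))
  have thick : ∀ (δ : ℝ) (hδ : 0 < δ) (S : Set X),
      ∫ x, (thickenedIndicator hδ S x : ℝ) ∂μ.1 = ∫ x, (thickenedIndicator hδ S x : ℝ) ∂ν.1 := by
    intro δ hδ S
    have hl := lipschitzWith_thickenedIndicator hδ S
    have hc : 0 < min δ 1 := lt_min hδ one_pos
    let f : KRTest X := ⟨fun x => min δ 1 * (thickenedIndicator hδ S x : ℝ), by
      intro x x'
      have h1 := hl.dist_le_mul x x'
      rw [NNReal.dist_eq] at h1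
      rw [← mul_sub, abs_mul, abs_of_pos hc]
      have h2 : ((δ.toNNReal)⁻¹ : ℝ≥0) = (δ⁻¹ : ℝ) := by
        simp [Real.coe_toNNReal δ hδ.le]
      rw [h2] at h1
      calc min δ 1 * |(thickenedIndicator hδ S x : ℝ) - thickenedIndicator hδ S x'|
          ≤ δ * (δ⁻¹ * dist x x') :=
            mul_le_mul (min_le_left _ _) h1 (abs_nonneg _) hδ.le
        _ = dist x x' := by field_simp, by
      intro x
      have h1 : (thickenedIndicator hδ S x : ℝ) ≤ 1 := by
        exact_mod_cast thickenedIndicator_le_one hδ S x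
      have h0 : (0 : ℝ) ≤ thickenedIndicator hδ S x := NNReal.coe_nonneg _
      rw [abs_of_nonneg (by positivity)]
      exact mul_le_one₀ (min_le_right _ _) h0 h1⟩
    have := key f
    simp only [f, integral_const_mul] at this
    exact mul_left_cancel₀ hc.ne' this
  have closed : ∀ S : Set X, IsClosed S → μ.1 S = ν.1 S := by
    intro S hS
    have hδ : ∀ n : ℕ, (0 : ℝ) < 1 / ((n : ℝ) + 1) := fun n => by positivity
    have h1 := tendsto_integral_thickenedIndicator_of_isClosed μ.1 hS hδ
      tendsto_one_div_add_atTop_nhds_zero_nat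
    have h2 := tendsto_integral_thickenedIndicator_of_isClosed ν.1 hS hδ
      tendsto_one_div_add_atTop_nhds_zero_nat
    simp only [fun n => thick _ (hδ n) S] at h1
    exact (measureReal_eq_measureReal_iff).1 (tendsto_nhds_unique h1 h2)
  apply Subtype.ext
  refine ext_of_generate_finite _ ?_ isPiSystem_isClosed (fun S hS => closed S hS)
    (closed _ isClosed_univ)
  rw [BorelSpace.measurable_eq (α := X), borel_eq_generateFrom_isClosed]

instance [BorelSpace X] : MetricSpace (SubProb X) where
  dist := krDist
  dist_self μ := by simp [krDist]
  dist_comm μ ν := by simp only [krDist, abs_sub_comm]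
  dist_triangle := krDist_triangle
  eq_of_dist_eq_zero {μ ν} h := eq_of_krDist_eq_zero μ ν h

end SubProb

/-! ### The recursive representation spaces -/

/-- A type bundled with a metric. -/
structure BundledMetric : Type 1 where
  carrier : Type
  [metric : MetricSpace carrier]

namespace BundledMetric

instance : CoeSort BundledMetric Type := ⟨carrier⟩

instance (X : BundledMetric) : MetricSpace X := X.metric

/-- Every bundled metric space carries its Borel `σ`-algebra. -/
instance (X : BundledMetric) : MeasurableSpace X := borel X

instance (X : BundledMetric) : BorelSpace X := ⟨rfl⟩

end BundledMetric

/-- Iterated degree measures `H_t`: `H_0` is the ball and `H_{t+1} = H_t × M_{≤ 1}(H_t)`, with the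
sum (`ℓ¹`) of the two distances. -/
def IDM (p₀ : ℕ) (r : ℝ) : ℕ → BundledMetric
  | 0 => ⟨Metric.closedBall (0 : EuclideanSpace ℝ (Fin p₀)) r⟩
  | t + 1 => ⟨WithLp 1 (IDM p₀ r t × SubProb (IDM p₀ r t))⟩

/-- Iterated neighborhood sets: `H_0` is the ball and `H_{t+1} = H_t × Haus(H_t × E)`, where
`Haus` is the space of nonempty compact subsets with the Hausdorff distance, and products carry
the sum (`ℓ¹`) of the two distances. -/
def INS (p₀ : ℕ) (r : ℝ) {F : Type} [NormedAddCommGroup F] (E : Set F) : ℕ → BundledMetric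
  | 0 => ⟨Metric.closedBall (0 : EuclideanSpace ℝ (Fin p₀)) r⟩
  | t + 1 => ⟨WithLp 1 (INS p₀ r E t ×
      TopologicalSpace.NonemptyCompacts (WithLp 1 (INS p₀ r E t × E)))⟩

/-! ### Induced representations and pseudo-metrics -/

/-- `∑_j c_j δ_{x_j}` for nonnegative `c_j` with `∑_j c_j ≤ 1`. -/
def SubProb.weightedDirac {X : Type} [MeasurableSpace X] {ι : Type} [Fintype ι] (c : ι → ℝ)
    (hc : ∀ j, 0 ≤ c j) (hsum : ∑ j, c j ≤ 1) (x : ι → X) : SubProb X :=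
  ⟨∑ j, ENNReal.ofReal (c j) • Measure.dirac (x j), by
    simp only [Measure.coe_finsetSum, Finset.sum_apply, Measure.smul_apply, measure_univ,
      smul_eq_mul, mul_one]
    rw [← ENNReal.ofReal_sum_of_nonneg fun j _ => hc j]
    exact ENNReal.ofReal_le_one.2 hsum⟩

section Induced

variable {p₀ : ℕ} {r : ℝ}

lemma AttributedGraph.sum_weight_le {E : Set ℝ} {W : ℝ} (hE : ∀ e ∈ E, 0 < e ∧ e ≤ W)
    (G : AttributedGraph p₀ r E) (u : G.V) :
    ∑ v : G.Nbr u, (G.w u v : ℝ) / (W * Fintype.card G.V) ≤ 1 := by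
  obtain ⟨v₀⟩ : Nonempty (G.Nbr u) := inferInstance
  have hW : 0 < W := (hE _ (G.w u v₀).2).1.trans_le (hE _ (G.w u v₀).2).2
  have hV : (0 : ℝ) < Fintype.card G.V := by exact_mod_cast Fintype.card_pos_iff.2 ⟨u⟩
  rw [← Finset.sum_div, div_le_one (by positivity)]
  have h1 : ∑ v : G.Nbr u, (G.w u v : ℝ) ≤ ∑ _v : G.Nbr u, W :=
    Finset.sum_le_sum fun v _ => (hE _ (G.w u v).2).2
  have h2 : (Fintype.card (G.Nbr u) : ℝ) ≤ Fintype.card G.V := by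
    exact_mod_cast Fintype.card_le_of_injective _ Subtype.val_injective
  simp only [Finset.sum_const, Finset.card_univ, nsmul_eq_mul] at h1
  nlinarith

lemma AttributedGraph.deg_pos {E : Set ℝ} (hE : ∀ e ∈ E, 0 < e)
    (G : AttributedGraph p₀ r E) (u : G.V) : 0 < G.deg u :=
  Finset.sum_pos (fun v _ => hE _ (G.w u v).2) Finset.univ_nonempty

/-- The normalized-sum induced iterated degree measure. The edge weights in `E ⊆ (0, W]` are
rescaled to `(0, 1]` by dividing by `W`, so that
`μ_u = |V(G)|⁻¹ ∑_{v ∈ N(u)} (w_{uv} / W) δ_{η_v}` has mass at most one;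
if `E ⊆ (0, 1]`, take `W = 1`. -/
def sumIDM {E : Set ℝ} {W : ℝ} (hE : ∀ e ∈ E, 0 < e ∧ e ≤ W) (G : AttributedGraph p₀ r E) :
    ∀ t, G.V → IDM p₀ r t
  | 0, u => G.attr u
  | t + 1, u => WithLp.toLp 1 (sumIDM hE G t u,
      SubProb.weightedDirac (fun v : G.Nbr u => (G.w u v : ℝ) / (W * Fintype.card G.V))
        (fun v => div_nonneg (hE _ (G.w u v).2).1.le (mul_nonneg
          ((hE _ (G.w u v).2).1.le.trans (hE _ (G.w u v).2).2) (Nat.cast_nonneg _)))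
        (G.sum_weight_le hE u) (fun v => sumIDM hE G t v))

/-- The mean induced iterated degree measure, with
`π_u = deg(u)⁻¹ ∑_{v ∈ N(u)} w_{uv} δ_{η_v}`. -/
def meanIDM {E : Set ℝ} (hE : ∀ e ∈ E, 0 < e) (G : AttributedGraph p₀ r E) :
    ∀ t, G.V → IDM p₀ r t
  | 0, u => G.attr u
  | t + 1, u => WithLp.toLp 1 (meanIDM hE G t u,
      SubProb.weightedDirac (fun v : G.Nbr u => (G.w u v : ℝ) / G.deg u)
        (fun v => div_nonneg (hE _ (G.w u v).2).le (G.deg_pos hE u).le)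
        (by rw [← Finset.sum_div]; exact (div_self (G.deg_pos hE u).ne').le)
        (fun v => meanIDM hE G t v))

/-- The induced iterated neighborhood set, with `A_u = {(η_v, w_{uv}) : v ∈ N(u)}`. -/
def inducedINS {F : Type} [NormedAddCommGroup F] {E : Set F} (G : AttributedGraph p₀ r E) :
    ∀ t, G.V → INS p₀ r E t
  | 0, u => G.attr u
  | t + 1, u => WithLp.toLp 1 (inducedINS G t u,
      ⟨⟨Set.range fun v : G.Nbr u => WithLp.toLp 1 (inducedINS G t v, G.w u v),
        (Set.finite_range _).isCompact⟩, Set.range_nonempty _⟩)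

/-- The normalized-sum pseudo-metric `d_{sum,L}` on rooted graphs. -/
abbrev sumPseudoMetric {E : Set ℝ} {W : ℝ} (hE : ∀ e ∈ E, 0 < e ∧ e ≤ W) (L : ℕ) :
    PseudoMetricSpace (RootedGraph p₀ r E) :=
  PseudoMetricSpace.induced (fun x => sumIDM hE x.1 L x.2) inferInstance

/-- The mean-aggregation pseudo-metric `d_{mean,L}` on rooted graphs. -/
abbrev meanPseudoMetric {E : Set ℝ} (hE : ∀ e ∈ E, 0 < e) (L : ℕ) :
    PseudoMetricSpace (RootedGraph p₀ r E) :=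
  PseudoMetricSpace.induced (fun x => meanIDM hE x.1 L x.2) inferInstance

/-- The max-aggregation pseudo-metric `d_{max,L}` on rooted graphs. -/
abbrev maxPseudoMetric {F : Type} [NormedAddCommGroup F] (E : Set F) (L : ℕ) :
    PseudoMetricSpace (RootedGraph p₀ r E) :=
  PseudoMetricSpace.induced (fun x => inducedINS x.1 L x.2) inferInstance

end Induced

end

/-! Every architecture factors through its representation space: the feature `h_u^{(t)}` is the
value at the representation of `(G, u)` of a map defined on all of `H_t`, respectively `H_t^max`,
which replaces the aggregation over neighbors by an integral, respectively by a coordinatewise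
supremum over a compact set. Both operations are Lipschitz for the Kantorovich–Rubinshtein,
respectively the Hausdorff, distance, so these maps are Lipschitz by induction on `t`. Minimum
aggregation is maximum aggregation with negated messages. The representation spaces are compact by
induction on `t`: on a compact space the measures of mass at most one are weakly compact, and weak
convergence is uniform on the test functions because these form a relatively compact set by
Arzelà–Ascoli. Covering numbers of a compact space are finite, and so are those of any
pseudo-metric induced from it. -/

open Set Filter Topology BoundedContinuousFunction

namespace KRTest

variable {X : Type} [MetricSpace X]

lemma lipschitzWith (f : KRTest X) : LipschitzWith 1 f.1 :=
  LipschitzWith.of_dist_le_mul fun x y => by simpa [Real.dist_eq] using f.2.1 x y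

/-- A test function as a bounded continuous function, so that Arzelà–Ascoli applies. -/
noncomputable def toBCF (f : KRTest X) : X →ᵇ ℝ :=
  .ofNormedAddCommGroup f.1 f.lipschitzWith.continuous 1 f.2.2

lemma isCompact_closure_range_toBCF [CompactSpace X] :
    IsCompact (closure (range (toBCF : KRTest X → X →ᵇ ℝ))) := by
  refine arzela_ascoli (Icc (-1) 1) isCompact_Icc _ ?_ ?_
  · rintro _ x ⟨f, rfl⟩
    exact abs_le.1 (f.2.2 x)
  · refine (LipschitzWith.uniformEquicontinuous _ 1 ?_).equicontinuous
    rintro ⟨_, f, rfl⟩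
    exact f.lipschitzWith

end KRTest

namespace SubProb

section MeasurableSpace

variable {X : Type} [MeasurableSpace X]

lemma measureReal_univ_le_one (μ : SubProb X) :
    μ.1.real univ ≤ 1 :=
  ENNReal.toReal_le_of_le_ofReal zero_le_one (by simpa using μ.2)

/-- A finite measure of mass at most one as a sub-probability measure: it transports the compactness
of the weak topology on finite measures to the Kantorovich–Rubinshtein distance. -/
def ofFiniteMeasure (μ : {μ : FiniteMeasure X // μ.mass ≤ 1}) : SubProb X :=
  ⟨μ.1, by rw [← FiniteMeasure.ennreal_mass]; exact_mod_cast μ.2⟩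

lemma surjective_ofFiniteMeasure : Function.Surjective (ofFiniteMeasure (X := X)) := fun μ =>
  ⟨⟨⟨μ.1, inferInstance⟩,
    ENNReal.coe_le_coe.1 ((FiniteMeasure.ennreal_mass (μ := ⟨μ.1, _⟩)).trans_le μ.2)⟩, rfl⟩

lemma integral_weightedDirac [MeasurableSingletonClass X] {V : Type*} [NormedAddCommGroup V]
    [NormedSpace ℝ V] [CompleteSpace V] {ι : Type} [Fintype ι] {c : ι → ℝ} (hc : ∀ j, 0 ≤ c j)
    (hsum : ∑ j, c j ≤ 1) (x : ι → X) (g : X → V) :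
    ∫ y, g y ∂(weightedDirac c hc hsum x).1 = ∑ j, c j • g (x j) := by
  have hintegrable (j : ι) : Integrable g (ENNReal.ofReal (c j) • Measure.dirac (x j)) :=
    (integrable_dirac (by simp)).smul_measure ENNReal.ofReal_ne_top
  rw [weightedDirac, integral_finsetSum_measure fun j _ => hintegrable j]
  exact Finset.sum_congr rfl fun j _ => by
    rw [integral_smul_measure, integral_dirac, ENNReal.toReal_ofReal (hc j)]

end MeasurableSpace

section Compactness

variable {X : Type} [MetricSpace X] [MeasurableSpace X] [BorelSpace X]

lemma lipschitzWith_integral_boundedContinuousFunction (μ : SubProb X) :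
    LipschitzWith 1 fun f : X →ᵇ ℝ => ∫ x, f x ∂μ.1 := by
  refine LipschitzWith.of_dist_le_mul fun f g => ?_
  rw [dist_eq_norm, dist_eq_norm, ← integral_sub (f.integrable μ.1) (g.integrable μ.1)]
  exact ((f - g).norm_integral_le_mul_norm μ.1).trans
    (mul_le_mul_of_nonneg_right μ.measureReal_univ_le_one (norm_nonneg _))

lemma continuous_ofFiniteMeasure [CompactSpace X] : Continuous (ofFiniteMeasure (X := X)) := by
  refine continuous_iff_continuousAt.2 fun μ => ?_
  let S := closure (range (KRTest.toBCF : KRTest X → X →ᵇ ℝ))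
  have : CompactSpace S := isCompact_iff_compactSpace.1 KRTest.isCompact_closure_range_toBCF
  let I (ν : {ν : FiniteMeasure X // ν.mass ≤ 1}) (f : S) : ℝ := ∫ x, f.1 x ∂(ofFiniteMeasure ν).1
  have equicontinuous : Equicontinuous I := (LipschitzWith.uniformEquicontinuous I (1 * 1) fun ν =>
    (lipschitzWith_integral_boundedContinuousFunction _).comp
      (LipschitzWith.subtype_val S)).equicontinuous
  have pointwise : Tendsto I (𝓝 μ) (𝓝 (I μ)) := tendsto_pi_nhds.2 fun f =>
    FiniteMeasure.tendsto_iff_forall_integral_tendsto.1 (continuous_subtype_val.tendsto μ) f.1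
  have uniform : TendstoUniformly I (I μ) (𝓝 μ) :=
    UniformFun.tendsto_iff_tendstoUniformly.1
      ((equicontinuous.tendsto_uniformFun_iff_pi _ _).2 pointwise)
  refine Metric.tendsto_nhds.2 fun ε hε => ?_
  filter_upwards [Metric.tendstoUniformly_iff.1 uniform (ε / 2) (half_pos hε)] with ν hν
  refine (ciSup_le fun f => ?_).trans_lt (half_lt_self hε)
  rw [abs_sub_comm]
  exact (hν ⟨f.toBCF, subset_closure ⟨f, rfl⟩⟩).le

instance compactSpace [CompactSpace X] : CompactSpace (SubProb X) := by
  have : CompactSpace {μ : FiniteMeasure X // μ.mass ≤ 1} :=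
    isCompact_iff_compactSpace.1 (isCompact_setOfPred_finiteMeasure_le_of_compactSpace X 1)
  exact surjective_ofFiniteMeasure.compactSpace continuous_ofFiniteMeasure

end Compactness

section Integral

variable {X : Type} [MetricSpace X] [MeasurableSpace X] [BorelSpace X]
  {V : Type*} [NormedAddCommGroup V] [NormedSpace ℝ V] [CompleteSpace V]

lemma abs_integral_sub_integral_le {f : X → ℝ} {C : ℝ≥0} (hf : LipschitzWith C f)
    (hC : ∀ x, |f x| ≤ C) (μ ν : SubProb X) :
    |∫ x, f x ∂μ.1 - ∫ x, f x ∂ν.1| ≤ C * dist μ ν := by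
  rcases eq_or_ne C 0 with rfl | hC0
  · have hf0 : f = 0 := funext fun x => abs_nonpos_iff.1 (hC x)
    simp [hf0]
  have hCpos : (0 : ℝ) < C := by positivity
  let g : KRTest X := ⟨fun x => (C : ℝ)⁻¹ * f x, fun x y => by
      rw [← mul_sub, abs_mul, abs_of_pos (inv_pos.2 hCpos), inv_mul_le_iff₀ hCpos]
      exact hf.dist_le_mul x y, fun x => by
      rw [abs_mul, abs_of_pos (inv_pos.2 hCpos), inv_mul_le_iff₀ hCpos, mul_one]
      exact hC x⟩
  have hg : |∫ x, g.1 x ∂μ.1 - ∫ x, g.1 x ∂ν.1| ≤ dist μ ν := le_krDist μ ν g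
  rwa [integral_const_mul, integral_const_mul, ← mul_sub, abs_mul, abs_of_pos (inv_pos.2 hCpos),
    inv_mul_le_iff₀ hCpos] at hg

-- Testing against a norming functional of the difference reduces this to real-valued functions.
lemma lipschitzWith_integral {g : X → V} {C : ℝ≥0} (hg : LipschitzWith C g) (hC : ∀ x, ‖g x‖ ≤ C)
    (hintegrable : ∀ μ : SubProb X, Integrable g μ.1) :
    LipschitzWith C fun μ : SubProb X => ∫ x, g x ∂μ.1 := by
  refine LipschitzWith.of_dist_le_mul fun μ ν => ?_
  obtain ⟨ℓ, hℓ, hnorm⟩ := exists_dual_vector'' ℝ (∫ x, g x ∂μ.1 - ∫ x, g x ∂ν.1)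
  have hlip : LipschitzWith C fun x => ℓ (g x) :=
    (ℓ.lipschitz.comp hg).weaken (mul_le_of_le_one_left' hℓ)
  have hbound (x : X) : |ℓ (g x)| ≤ C := (ℓ.le_of_opNorm_le hℓ (g x)).trans (by simpa using hC x)
  calc dist (∫ x, g x ∂μ.1) (∫ x, g x ∂ν.1)
      = ∫ x, ℓ (g x) ∂μ.1 - ∫ x, ℓ (g x) ∂ν.1 := by
        rw [dist_eq_norm, ℓ.integral_comp_comm (hintegrable μ),
          ℓ.integral_comp_comm (hintegrable ν), ← map_sub,
          hnorm, RCLike.ofReal_real_eq_id, id]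
    _ ≤ C * dist μ ν := (le_abs_self _).trans (abs_integral_sub_integral_le hlip hbound μ ν)

lemma exists_lipschitzWith_integral [CompactSpace X] {g : X → V} {K : ℝ≥0}
    (hg : LipschitzWith K g) : ∃ C, LipschitzWith C fun μ : SubProb X => ∫ x, g x ∂μ.1 := by
  obtain ⟨B, hB⟩ := (isCompact_range hg.continuous).isBounded.exists_norm_le
  refine ⟨max K B.toNNReal, lipschitzWith_integral (hg.weaken (le_max_left _ _)) (fun x => ?_)
    fun μ => hg.continuous.integrable_of_hasCompactSupport (.of_compactSpace g)⟩
  exact (hB _ (mem_range_self x)).trans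
    ((Real.le_coe_toNNReal B).trans (NNReal.coe_le_coe.2 (le_max_right _ _)))

end Integral

end SubProb

lemma compactSpace_withLp_prod (q : ℝ≥0∞) (α β : Type*) [TopologicalSpace α] [TopologicalSpace β]
    [CompactSpace α] [CompactSpace β] : CompactSpace (WithLp q (α × β)) :=
  (WithLp.homeomorphProd q α β).symm.compactSpace

instance IDM.compactSpace (p₀ : ℕ) (r : ℝ) : ∀ t, CompactSpace (IDM p₀ r t)
  | 0 => isCompact_iff_compactSpace.1 (isCompact_closedBall _ _)
  | t + 1 =>
    have := IDM.compactSpace p₀ r t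
    compactSpace_withLp_prod 1 (IDM p₀ r t) (SubProb (IDM p₀ r t))

instance INS.compactSpace (p₀ : ℕ) (r : ℝ) {F : Type} [NormedAddCommGroup F] (E : Set F)
    [CompactSpace E] : ∀ t, CompactSpace (INS p₀ r E t)
  | 0 => isCompact_iff_compactSpace.1 (isCompact_closedBall _ _)
  | t + 1 =>
    have := INS.compactSpace p₀ r E t
    have := compactSpace_withLp_prod 1 (INS p₀ r E t) E
    compactSpace_withLp_prod 1 (INS p₀ r E t)
      (TopologicalSpace.NonemptyCompacts (WithLp 1 (INS p₀ r E t × E)))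

namespace IsLipschitzInPair

variable {X Y Z : Type*} [NormedAddCommGroup X] [NormedAddCommGroup Y] [NormedAddCommGroup Z]
  {f : X → Y → Z}

lemma exists_lipschitzWith_comp {α β : Type*} [PseudoMetricSpace α] [PseudoMetricSpace β]
    (hf : IsLipschitzInPair f) {g : α → X} {h : β → Y} {K K' : ℝ≥0} (hg : LipschitzWith K g)
    (hh : LipschitzWith K' h) :
    ∃ C, LipschitzWith C fun z : WithLp 1 (α × β) => f (g z.fst) (h z.snd) := by
  obtain ⟨C₁, C₂, hC₁, hC₂, hf⟩ := hf
  refine ⟨_, LipschitzWith.of_dist_le' (K := max (C₁ * K) (C₂ * K')) fun z z' => ?_⟩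
  calc dist (f (g z.fst) (h z.snd)) (f (g z'.fst) (h z'.snd))
      ≤ C₁ * dist (g z.fst) (g z'.fst) + C₂ * dist (h z.snd) (h z'.snd) := by
        simpa only [dist_eq_norm] using hf _ _ _ _
    _ ≤ C₁ * (K * dist z.fst z'.fst) + C₂ * (K' * dist z.snd z'.snd) := by
        gcongr
        exacts [hg.dist_le_mul _ _, hh.dist_le_mul _ _]
    _ = (C₁ * K) * dist z.fst z'.fst + (C₂ * K') * dist z.snd z'.snd := by ring
    _ ≤ max (C₁ * K) (C₂ * K') * dist z.fst z'.fst +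
          max (C₁ * K) (C₂ * K') * dist z.snd z'.snd := by
        gcongr
        exacts [le_max_left _ _, le_max_right _ _]
    _ = max (C₁ * K) (C₂ * K') * dist z z' := by
        rw [WithLp.prod_dist_eq_add (by simp) z z']
        simp [mul_add]

lemma neg (hf : IsLipschitzInPair f) : IsLipschitzInPair fun x y => -f x y := by
  obtain ⟨C₁, C₂, hC₁, hC₂, hf⟩ := hf
  refine ⟨C₁, C₂, hC₁, hC₂, fun x x' y y' => ?_⟩
  simpa only [neg_sub_neg, norm_sub_rev (f x' y')] using hf x x' y y'

lemma comp_neg_right (hf : IsLipschitzInPair f) : IsLipschitzInPair fun x y => f x (-y) := by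
  obtain ⟨C₁, C₂, hC₁, hC₂, hf⟩ := hf
  refine ⟨C₁, C₂, hC₁, hC₂, fun x x' y y' => ?_⟩
  simpa only [neg_sub_neg, norm_sub_rev y'] using hf x x' (-y) (-y')

end IsLipschitzInPair

namespace IDM

variable {p : ℕ → ℕ} {r : ℝ}

/-- The feature computed by the update maps `φ` from an iterated degree measure. The aggregated
message is `W` times an integral, where `W` undoes the rescaling of the edge weights in `sumIDM`. -/
noncomputable def feature (φ : UpdateMaps p) (W : ℝ) :
    ∀ t, IDM (p 0) r t → EuclideanSpace ℝ (Fin (p t))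
  | 0, x => (show Metric.closedBall (0 : EuclideanSpace ℝ (Fin (p 0))) r from x).1
  | t + 1, x =>
    let y : WithLp 1 (IDM (p 0) r t × SubProb (IDM (p 0) r t)) := x
    φ t (feature φ W t y.fst) (W • ∫ z, feature φ W t z ∂y.snd.1)

lemma exists_lipschitzWith_feature {φ : UpdateMaps p} {L : ℕ} (W : ℝ)
    (hφ : ∀ t < L, IsLipschitzInPair (φ t)) : ∃ K, LipschitzWith K (feature (r := r) φ W L) := by
  induction L with
  | zero => exact ⟨1, LipschitzWith.subtype_val _⟩
  | succ t ih =>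
    obtain ⟨K, hK⟩ := ih fun s hs => hφ s (hs.trans t.lt_succ_self)
    obtain ⟨C, hC⟩ := SubProb.exists_lipschitzWith_integral hK
    obtain ⟨D, hD⟩ :=
      (hφ t t.lt_succ_self).exists_lipschitzWith_comp hK ((lipschitzWith_smul W).comp hC)
    exact ⟨D, hD⟩

lemma feature_toLp_weightedDirac (φ : UpdateMaps p) (W : ℝ) {t : ℕ} (η : IDM (p 0) r t) {ι : Type}
    [Fintype ι] {c : ι → ℝ} (hc : ∀ j, 0 ≤ c j) (hsum : ∑ j, c j ≤ 1) (x : ι → IDM (p 0) r t) :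
    feature φ W (t + 1) (WithLp.toLp 1 (η, SubProb.weightedDirac c hc hsum x)) =
      φ t (feature φ W t η) (∑ j, (W * c j) • feature φ W t (x j)) := by
  calc _ = φ t (feature φ W t η) (W • ∑ j, c j • feature φ W t (x j)) :=
        congrArg (fun m => φ t _ (W • m)) (SubProb.integral_weightedDirac hc hsum x _)
    _ = _ := by simp only [Finset.smul_sum, smul_smul]

lemma feature_sumIDM (φ : UpdateMaps p) {E : Set ℝ} {W : ℝ} (hE : ∀ e ∈ E, 0 < e ∧ e ≤ W)
    (G : AttributedGraph (p 0) r E) :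
    ∀ t u, feature φ W t (sumIDM hE G t u) = sumFeature φ G t u
  | 0, _ => rfl
  | t + 1, u => by
    obtain ⟨v₀⟩ : Nonempty (G.Nbr u) := inferInstance
    have hW : W ≠ 0 := ((hE _ (G.w u v₀).2).1.trans_le (hE _ (G.w u v₀).2).2).ne'
    have weight (v : G.Nbr u) :
        W * ((G.w u v : ℝ) / (W * Fintype.card G.V)) = (Fintype.card G.V : ℝ)⁻¹ * G.w u v := by
      field_simp
    simp only [sumIDM, feature_toLp_weightedDirac, feature_sumIDM φ hE G t, sumFeature, weight,
      Finset.smul_sum, smul_smul]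

lemma feature_meanIDM (φ : UpdateMaps p) {E : Set ℝ} (hE : ∀ e ∈ E, 0 < e)
    (G : AttributedGraph (p 0) r E) :
    ∀ t u, feature φ 1 t (meanIDM hE G t u) = meanFeature φ G t u
  | 0, _ => rfl
  | t + 1, u => by
    simp only [meanIDM, feature_toLp_weightedDirac, feature_meanIDM φ hE G t, meanFeature, one_mul,
      div_eq_inv_mul, Finset.smul_sum, smul_smul]

end IDM

section CoordSup

open TopologicalSpace (NonemptyCompacts)

variable {Z ι : Type*}

/-- The coordinatewise supremum of `g` over `A`, which extends `coordMax` to infinite families. A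
coordinate that is unbounded on `A` has supremum `0`. -/
noncomputable def coordSup (g : Z → EuclideanSpace ℝ ι) (A : Set Z) : EuclideanSpace ℝ ι :=
  WithLp.toLp 2 fun i => ⨆ z : A, g z i

lemma coordSup_range {κ : Type} [Fintype κ] [Nonempty κ] {n : ℕ}
    (g : Z → EuclideanSpace ℝ (Fin n)) (x : κ → Z) :
    coordSup g (range x) = coordMax fun k => g (x k) := by
  ext i
  simp only [coordSup, coordMax, Finset.sup'_univ_eq_ciSup]
  exact iSup_range' (fun z => g z i) x

variable [MetricSpace Z]

lemma exists_dist_le_dist_nonemptyCompacts (A B : NonemptyCompacts Z) {x : Z} (hx : x ∈ A) :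
    ∃ y ∈ B, dist x y ≤ dist A B := by
  obtain ⟨y, hy, hxy⟩ := B.isCompact.exists_infDist_eq_dist B.nonempty x
  refine ⟨y, hy, hxy ▸ Metric.infDist_le_hausdorffDist_of_mem hx ?_⟩
  exact Metric.hausdorffEDist_ne_top_of_nonempty_of_bounded A.nonempty B.nonempty
    A.isCompact.isBounded B.isCompact.isBounded

lemma lipschitzWith_iSup_nonemptyCompacts {f : Z → ℝ} {K : ℝ≥0} (hf : LipschitzWith K f) :
    LipschitzWith K fun A : NonemptyCompacts Z => ⨆ z : (A : Set Z), f z := by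
  refine LipschitzWith.of_le_add_mul K fun A B => ?_
  have : Nonempty (A : Set Z) := A.nonempty.to_subtype
  have hbdd : BddAbove (range fun z : (B : Set Z) => f z) := by
    simpa only [image_eq_range] using B.isCompact.bddAbove_image hf.continuous.continuousOn
  refine ciSup_le fun ⟨x, hx⟩ => ?_
  obtain ⟨y, hy, hxy⟩ := exists_dist_le_dist_nonemptyCompacts A B hx
  calc f x ≤ f y + K * dist x y := hf.le_add_mul x y
    _ ≤ (⨆ z : (B : Set Z), f z) + K * dist A B := by
      gcongr
      exact le_ciSup hbdd ⟨y, hy⟩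

lemma exists_lipschitzWith_coordSup [Fintype ι] {g : Z → EuclideanSpace ℝ ι} {K : ℝ≥0}
    (hg : LipschitzWith K g) :
    ∃ C, LipschitzWith C fun A : NonemptyCompacts Z => coordSup g A := by
  have hcoord (i : ι) : LipschitzWith K fun z => g z i := by
    simpa [Function.comp_def] using
      (LipschitzWith.eval i).comp ((PiLp.lipschitzWith_ofLp 2 _).comp hg)
  have hpi : LipschitzWith K fun (A : NonemptyCompacts Z) i => ⨆ z : (A : Set Z), g z i :=
    fun A B => edist_pi_le_iff.2 fun i => lipschitzWith_iSup_nonemptyCompacts (hcoord i) A B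
  exact ⟨_, (PiLp.lipschitzWith_toLp 2 _).comp hpi⟩

end CoordSup

namespace INS

open TopologicalSpace (NonemptyCompacts)

variable {p : ℕ → ℕ} {r : ℝ} {F : Type} [NormedAddCommGroup F] {E : Set F}

/-- The feature computed by the update maps `φ` and the message maps `M` from an iterated
neighborhood set, with the maximum over neighbors replaced by a supremum over a compact set. -/
noncomputable def feature (φ : UpdateMaps p) (M : MessageMaps p F) :
    ∀ t, INS (p 0) r E t → EuclideanSpace ℝ (Fin (p t))
  | 0, x => (show Metric.closedBall (0 : EuclideanSpace ℝ (Fin (p 0))) r from x).1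
  | t + 1, x =>
    let y : WithLp 1 (INS (p 0) r E t × NonemptyCompacts (WithLp 1 (INS (p 0) r E t × E))) := x
    φ t (feature φ M t y.fst)
      (coordSup (fun z : WithLp 1 (INS (p 0) r E t × E) => M t (feature φ M t z.fst) z.snd) y.snd)

lemma exists_lipschitzWith_feature {φ : UpdateMaps p} {M : MessageMaps p F} {L : ℕ}
    (hφ : ∀ t < L, IsLipschitzInPair (φ t)) (hM : ∀ t < L, IsLipschitzInPair (M t)) :
    ∃ K, LipschitzWith K (feature (r := r) (E := E) φ M L) := by
  induction L with
  | zero => exact ⟨1, LipschitzWith.subtype_val _⟩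
  | succ t ih =>
    obtain ⟨K, hK⟩ := ih (fun s hs => hφ s (hs.trans t.lt_succ_self))
      fun s hs => hM s (hs.trans t.lt_succ_self)
    obtain ⟨B, hB⟩ :=
      (hM t t.lt_succ_self).exists_lipschitzWith_comp hK (LipschitzWith.subtype_val E)
    obtain ⟨C, hC⟩ := exists_lipschitzWith_coordSup hB
    obtain ⟨D, hD⟩ := (hφ t t.lt_succ_self).exists_lipschitzWith_comp hK hC
    exact ⟨D, hD⟩

lemma feature_inducedINS (φ : UpdateMaps p) (M : MessageMaps p F)
    (G : AttributedGraph (p 0) r E) :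
    ∀ t u, feature φ M t (inducedINS G t u) = maxFeature φ M G t u
  | 0, _ => rfl
  | t + 1, u => by
    calc feature φ M (t + 1) (inducedINS G (t + 1) u)
        = φ t (feature φ M t (inducedINS G t u))
            (coordMax fun v : G.Nbr u => M t (feature φ M t (inducedINS G t v)) (G.w u v)) :=
          congrArg (φ t _) (coordSup_range _ _)
      _ = maxFeature φ M G (t + 1) u := by simp only [feature_inducedINS φ M G t, maxFeature]

end INS

lemma coordMin_eq_neg_coordMax_neg {ι : Type} [Fintype ι] [Nonempty ι] {n : ℕ}
    (x : ι → EuclideanSpace ℝ (Fin n)) : coordMin x = -coordMax fun j => -x j := by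
  ext i
  let negIso : ℝ ≃o ℝᵒᵈ := OrderIso.neg ℝ
  exact neg_eq_iff_eq_neg.1 (map_finset_inf' negIso Finset.univ_nonempty fun j => x j i)

lemma minFeature_eq_maxFeature_neg {p : ℕ → ℕ} {r : ℝ} {F : Type} {E : Set F} (φ : UpdateMaps p)
    (M : MessageMaps p F) (G : AttributedGraph (p 0) r E) :
    ∀ t u, minFeature φ M G t u =
      maxFeature (fun t x y => φ t x (-y)) (fun t x e => -M t x e) G t u
  | 0, _ => rfl
  | t + 1, u => by
    simp only [minFeature, maxFeature, minFeature_eq_maxFeature_neg φ M G t,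
      coordMin_eq_neg_coordMax_neg]

lemma RootedGraph.nonempty {p₀ : ℕ} {r : ℝ} (hr : 0 ≤ r) {F : Type} {E : Set F}
    (hE : E.Nonempty) : Nonempty (RootedGraph p₀ r E) :=
  ⟨⟨{ V := Bool
      graph := ⊤
      attr := fun _ => ⟨0, Metric.mem_closedBall_self hr⟩
      edgeFeature := fun _ => ⟨hE.some, hE.some_mem⟩
      exists_adj := fun u => ⟨!u, by cases u <;> simp⟩ }, true⟩⟩

namespace IsFiniteLipschitzClass

lemma of_lipschitzWith_comp {X Θ Y Z : Type*} [PseudoMetricSpace Y] [PseudoMetricSpace Z]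
    [CompactSpace Z] (hX : Nonempty X) (g : X → Z) {f : Θ → X → Y} {h : Θ → Z → Y}
    (hh : ∀ θ, ∃ K, LipschitzWith K (h θ)) (hf : ∀ θ x, h θ (g x) = f θ x) :
    IsFiniteLipschitzClass (.induced g inferInstance) f := by
  let := PseudoMetricSpace.induced g inferInstance
  refine ⟨hX, fun θ => ?_, fun ε hε => ?_⟩
  · obtain ⟨K, hK⟩ := hh θ
    exact ⟨K, fun x y => by rw [← hf, ← hf]; exact hK (g x) (g y)⟩
  · have : TotallyBounded (univ : Set X) :=
      totallyBounded_preimage ⟨rfl⟩ (isCompact_univ (X := Z)).totallyBounded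
    obtain ⟨N, hN, hfin, hcover⟩ := Metric.exists_finite_isCover_of_totallyBounded hε.ne' this
    exact (hcover.coveringNumber_le_encard hN).trans_lt hfin.encard_lt_top

variable {Θ : Type*} {p : ℕ → ℕ} {r : ℝ} {L : ℕ} {φ : Θ → UpdateMaps p}

lemma sumFeature {E : Set ℝ} {W : ℝ} (hr : 0 ≤ r) (hne : E.Nonempty)
    (hE : ∀ e ∈ E, 0 < e ∧ e ≤ W) (hφ : ∀ θ, ∀ t < L, IsLipschitzInPair (φ θ t)) :
    IsFiniteLipschitzClass (sumPseudoMetric hE L)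
      fun θ (x : RootedGraph (p 0) r E) => sumFeature (φ θ) x.1 L x.2 :=
  of_lipschitzWith_comp (RootedGraph.nonempty hr hne) _
    (fun θ => IDM.exists_lipschitzWith_feature W (hφ θ))
    fun θ x => IDM.feature_sumIDM (φ θ) hE x.1 L x.2

lemma meanFeature {E : Set ℝ} (hr : 0 ≤ r) (hne : E.Nonempty) (hE : ∀ e ∈ E, 0 < e)
    (hφ : ∀ θ, ∀ t < L, IsLipschitzInPair (φ θ t)) :
    IsFiniteLipschitzClass (meanPseudoMetric hE L)
      fun θ (x : RootedGraph (p 0) r E) => meanFeature (φ θ) x.1 L x.2 :=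
  of_lipschitzWith_comp (RootedGraph.nonempty hr hne) _
    (fun θ => IDM.exists_lipschitzWith_feature 1 (hφ θ))
    fun θ x => IDM.feature_meanIDM (φ θ) hE x.1 L x.2

variable {F : Type} [NormedAddCommGroup F] {E : Set F} [CompactSpace E] {M : Θ → MessageMaps p F}

lemma maxFeature (hr : 0 ≤ r) (hne : E.Nonempty) (hφ : ∀ θ, ∀ t < L, IsLipschitzInPair (φ θ t))
    (hM : ∀ θ, ∀ t < L, IsLipschitzInPair (M θ t)) :
    IsFiniteLipschitzClass (maxPseudoMetric E L)
      fun θ (x : RootedGraph (p 0) r E) => maxFeature (φ θ) (M θ) x.1 L x.2 :=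
  of_lipschitzWith_comp (RootedGraph.nonempty hr hne) _
    (fun θ => INS.exists_lipschitzWith_feature (hφ θ) (hM θ))
    fun θ x => INS.feature_inducedINS (φ θ) (M θ) x.1 L x.2

lemma minFeature (hr : 0 ≤ r) (hne : E.Nonempty) (hφ : ∀ θ, ∀ t < L, IsLipschitzInPair (φ θ t))
    (hM : ∀ θ, ∀ t < L, IsLipschitzInPair (M θ t)) :
    IsFiniteLipschitzClass (maxPseudoMetric E L)
      fun θ (x : RootedGraph (p 0) r E) => minFeature (φ θ) (M θ) x.1 L x.2 := by
  simp only [minFeature_eq_maxFeature_neg]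
  exact maxFeature hr hne (fun θ t ht => (hφ θ t ht).comp_neg_right) fun θ t ht => (hM θ t ht).neg

end IsFiniteLipschitzClass

theorem mainTheorem2_general {Θ : Type*} (p : ℕ → ℕ) (r : ℝ) (hr : 0 ≤ r) (L : ℕ)
    (φ : Θ → UpdateMaps p) (hφ : ∀ θ, ∀ t < L, IsLipschitzInPair (φ θ t)) :
    (CompactSpace (IDM (p 0) r L) ∧
      ∀ (E : Set ℝ) (_ : E.Nonempty),
        (∀ (W : ℝ) (hE : ∀ e ∈ E, 0 < e ∧ e ≤ W),
          IsFiniteLipschitzClass (sumPseudoMetric hE L)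
            (fun θ (x : RootedGraph (p 0) r E) => sumFeature (φ θ) x.1 L x.2)) ∧
        (∀ hE : ∀ e ∈ E, 0 < e,
          IsFiniteLipschitzClass (meanPseudoMetric hE L)
            (fun θ (x : RootedGraph (p 0) r E) => meanFeature (φ θ) x.1 L x.2))) ∧
    (∀ (F : Type) [NormedAddCommGroup F] (E : Set F) (_ : E.Nonempty) (_ : IsCompact E)
        (M : Θ → MessageMaps p F) (_ : ∀ θ, ∀ t < L, IsLipschitzInPair (M θ t)),
      CompactSpace (INS (p 0) r E L) ∧
      IsFiniteLipschitzClass (maxPseudoMetric E L)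
        (fun θ (x : RootedGraph (p 0) r E) => maxFeature (φ θ) (M θ) x.1 L x.2) ∧
      IsFiniteLipschitzClass (maxPseudoMetric E L)
        (fun θ (x : RootedGraph (p 0) r E) => minFeature (φ θ) (M θ) x.1 L x.2)) := by
  refine ⟨⟨IDM.compactSpace (p 0) r L, fun E hne => ⟨fun W hE => ?sum, fun hE => ?mean⟩⟩,
    fun F _ E hne hcompact M hM => ?neighborhood_sets⟩
  case sum => exact .sumFeature hr hne hE hφ
  case mean => exact .meanFeature hr hne hE hφ
  case neighborhood_sets =>
    have : CompactSpace E := isCompact_iff_compactSpace.1 hcompact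
    exact ⟨INS.compactSpace (p 0) r E L, .maxFeature hr hne hφ hM, .minFeature hr hne hφ hM⟩

theorem mainTheorem2 {Θ : Type*} (p : ℕ → ℕ) (r : ℝ) (hr : 0 < r) (L : ℕ)
    (φ : Θ → UpdateMaps p) (hφ : ∀ θ, ∀ t < L, IsLipschitzInPair (φ θ t)) :
    -- normalized-sum and mean aggregation, with positive edge weights
    (CompactSpace (IDM (p 0) r L) ∧
      ∀ (E : Set ℝ) (_ : E.Nonempty) (_ : IsCompact E),
        (∀ (W : ℝ) (hE : ∀ e ∈ E, 0 < e ∧ e ≤ W),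
          IsFiniteLipschitzClass (sumPseudoMetric hE L)
            (fun θ (x : RootedGraph (p 0) r E) => sumFeature (φ θ) x.1 L x.2)) ∧
        (∀ hE : ∀ e ∈ E, 0 < e,
          IsFiniteLipschitzClass (meanPseudoMetric hE L)
            (fun θ (x : RootedGraph (p 0) r E) => meanFeature (φ θ) x.1 L x.2))) ∧
    -- max and min aggregation, with edge features in a normed space
    (∀ (F : Type) [NormedAddCommGroup F] [NormedSpace ℝ F] (E : Set F)
        (_ : E.Nonempty) (_ : IsCompact E)
        (M : Θ → MessageMaps p F) (_ : ∀ θ, ∀ t < L, IsLipschitzInPair (M θ t)),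
      CompactSpace (INS (p 0) r E L) ∧
      IsFiniteLipschitzClass (maxPseudoMetric E L)
        (fun θ (x : RootedGraph (p 0) r E) => maxFeature (φ θ) (M θ) x.1 L x.2) ∧
      IsFiniteLipschitzClass (maxPseudoMetric E L)
        (fun θ (x : RootedGraph (p 0) r E) => minFeature (φ θ) (M θ) x.1 L x.2)) := by
  have h := mainTheorem2_general p r hr.le L φ hφ
  exact ⟨⟨h.1.1, fun E hne _ => h.1.2 E hne⟩, fun F _ _ => h.2 F⟩
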